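/- Conventions. A $*$-field is a (commutative) field $F$ with an involution $r\mapsto r^*$ (an automorphism with $r^{**}=r$, possibly the identity). A $d$-dimensional inner product space over $F$ is a $d$-dimensional $F$-vector space $V$ with a form $\langle\cdot\mid\cdot\rangle:V\times V\to F$ which is additive in both arguments and satisfies $\langle vr\mid ws\rangle=r^*\langle v\mid w\rangle s$, $\langle w\mid v\rangle=\langle v\mid w\rangle^*$, is non-degenerate ($\langle w\mid v\rangle=0$ for all $w$ implies $v=0$) and non-alternate ($\langle v\mid v\rangle\neq 0$ for some $v$). Put $|v|=\langle v\mid v\rangle$. A tuple $\bar\alpha=(\alpha_1,\dots,\alpha_d)\in F^d$ is admissible for $V$ if $\alpha_1=1$, $\alpha_i=\alpha_i^*\neq 0$ for all $i$, and there is a basis $v_1,\dots,v_d$ of $V$ with $\langle v_i\mid v_j\rangle=0$ for $i\ne j$ and $\alpha_i=|v_1|^{-1}|v_i|$ for all $i$. $\mathsf L(V)$ is the set of linear subspaces of $V$ with the operations $U_1+U_2$, the constant $0$ and $U^\perp=\{x\in V\mid \langle x\mid u\rangle=0\text{ for all }u\in U\}$; $\Lambda_L$ is the first order language with signature $+,0,{}^\perp$.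 $\Lambda_F^+$ is the first order language of $*$-rings (signature $+,\cdot,-,{}^*,0,1$) with additional constants $c_1,\dots,c_d$, and $F_{\bar\alpha}$ is $F$ as a structure for $\Lambda_F^+$ with $c_i$ interpreted as $\alpha_i$. A universal sentence is a sentence $\forall x_1\cdots\forall x_n\,\psi$ with $\psi$ quantifier free. Corollary (universal sentences). Fix $d\ge 1$. (1) For every universal sentence $\phi$ of $\Lambda_L$ there is a universal sentence $\hat\phi$ of $\Lambda_F^+$ such that, for every $*$-field $F$, every $d$-dimensional inner product space $V$ over $F$ and every $\bar\alpha$ admissible for $V$: $\mathsf L(V)\models\phi$ if and only if $F_{\bar\alpha}\models\hat\phi$. (2) The same holds with dimension restrictions on the variables: for every quantifier free formula $\psi(x_1,\dots,x_n)$ of $\Lambda_L$, every set $S\subseteq\{1,\dots,n\}$ and all integers $0\le d_k\le d$ ($k\in S$) there is a universal sentence $\hat\phi$ of $\Lambda_F^+$ such that, for all $F$, $V$, $\bar\alpha$ as in (1): $\mathsf L(V)\models\psi(u_1,\dots,u_n)$ for all linear subspaces $u_1,\dots,u_n$ of $V$ with $\dim u_k=d_k$ for all $k\in S$, if and only if $F_{\bar\alpha}\models\hat\phi$.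 -/

import Mathlib

namespace SubspaceLattice

open FirstOrder FirstOrder.Language

/-! ## The languages -/

/-- Function symbols of lattices with involution: join `+`, the constant `0`, and `ᗮ`. -/
inductive LatFunc : ℕ → Type
  | add : LatFunc 2
  | zero : LatFunc 0
  | perp : LatFunc 1

/-- The first order language `Λ_L` of bounded lattices with involution, in the
signature `+, 0, ᗮ` (no relation symbols except equality). -/
def langL : FirstOrder.Language.{0, 0} where
  Functions := LatFunc
  Relations := fun _ => Empty

/-- Function symbols of `*`-rings. -/
inductive StarRingFunc : ℕ → Type
  | add : StarRingFunc 2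
  | mul : StarRingFunc 2
  | neg : StarRingFunc 1
  | star : StarRingFunc 1
  | zero : StarRingFunc 0
  | one : StarRingFunc 0

/-- The first order language `Λ_F` of `*`-rings (no relation symbols except equality). -/
def langF : FirstOrder.Language.{0, 0} where
  Functions := StarRingFunc
  Relations := fun _ => Empty

/-- The language `Λ_F⁺`: the language of `*`-rings with `d` additional constant symbols. -/
abbrev langFPlus (d : ℕ) : FirstOrder.Language.{0, 0} := langF[[Fin d]]

/-! ## Inner product spaces -/

section Spaces

variable {F : Type*} [Field F] [StarRing F] {V : Type*} [AddCommGroup V] [Module F V]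

/-- A form `B` on `V`, additive in both arguments, with `B (r • v) (s • w) = star r * B v w * s`,
is an inner product if it is `*`-hermitean, non-degenerate and non-alternate. -/
structure IsInnerProduct (B : V →ₗ⋆[F] V →ₗ[F] F) : Prop where
  hermitean : ∀ v w, B w v = star (B v w)
  nondegenerate : ∀ v, (∀ w, B w v = 0) → v = 0
  nonalternate : ∃ v, B v v ≠ 0

/-- The orthogonal `{x | ∀ u ∈ U, B x u = 0}` of a linear subspace `U`. -/
def orth (B : V →ₗ⋆[F] V →ₗ[F] F) (U : Submodule F V) : Submodule F V where
  carrier := {x | ∀ u ∈ U, B x u = 0}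
  add_mem' := by
    intro x y hx hy u hu
    simp [hx u hu, hy u hu]
  zero_mem' := by
    intro u _
    simp
  smul_mem' := by
    intro r x hx u hu
    simp [hx u hu]

/-- `α` is admissible for `V` with the form `B`: `α₁ = 1`, all `αᵢ` are symmetric and nonzero, and
`αᵢ = |v₁|⁻¹ |vᵢ|` for some orthogonal basis `v₁, …, v_d` of `V`, where `|v|` is `B v v`. -/
structure IsAdmissible {d : ℕ} [NeZero d] (B : V →ₗ⋆[F] V →ₗ[F] F) (α : Fin d → F) : Prop where
  first_eq_one : α 0 = 1
  star_eq : ∀ i, star (α i) = α i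
  ne_zero : ∀ i, α i ≠ 0
  exists_basis : ∃ v : Module.Basis (Fin d) F V,
    (∀ i j, i ≠ j → B (v i) (v j) = 0) ∧
    ∀ i, α i = (B (v 0) (v 0))⁻¹ * B (v i) (v i)

/-! ## The structures `L(V)` and `F_α` -/

/-- The lattice with involution `L(V)` of all linear subspaces of `V`. -/
@[reducible]
def latStructure (B : V →ₗ⋆[F] V →ₗ[F] F) : langL.Structure (Submodule F V) where
  funMap := fun {n} (f : LatFunc n) =>
    match n, f with
    | _, .add => fun x => x 0 ⊔ x 1
    | _, .zero => fun _ => ⊥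
    | _, .perp => fun x => orth B (x 0)
  RelMap := fun r => r.elim

/-- The `*`-field `F` as a structure for the language of `*`-rings. -/
@[reducible]
def starRingStructure (F : Type*) [Field F] [StarRing F] : langF.Structure F where
  funMap := fun {n} (f : StarRingFunc n) =>
    match n, f with
    | _, .add => fun x => x 0 + x 1
    | _, .mul => fun x => x 0 * x 1
    | _, .neg => fun x => - x 0
    | _, .star => fun x => star (x 0)
    | _, .zero => fun _ => 0
    | _, .one => fun _ => 1
  RelMap := fun r => r.elim

/-- `F_α`: the `*`-field `F` with the additional constants interpreted as `α₁, …, α_d`. -/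
@[reducible]
def fieldStructure {d : ℕ} (α : Fin d → F) : (langFPlus d).Structure F :=
  letI := starRingStructure F
  letI := constantsOn.structure α
  inferInstance

/-- `L(V) ⊨ φ`. -/
def LatModels (B : V →ₗ⋆[F] V →ₗ[F] F) (φ : langL.Sentence) : Prop :=
  letI := latStructure B
  Submodule F V ⊨ φ

/-- `F_α ⊨ φ`. -/
def FieldModels {d : ℕ} (α : Fin d → F) (φ : (langFPlus d).Sentence) : Prop :=
  letI := fieldStructure α
  F ⊨ φ

/-- Validity in `L(V)` of the universal sentence `∀ x₁ … xₙ, ψ` with dimension restrictions: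
`x_k` ranges over the subspaces of dimension `m` if `δ k = some m`, and over all subspaces
if `δ k = none`. -/
def LatModelsRestricted (B : V →ₗ⋆[F] V →ₗ[F] F) {n : ℕ} (ψ : langL.BoundedFormula Empty n)
    (δ : Fin n → Option ℕ) : Prop :=
  letI := latStructure B
  ∀ u : Fin n → Submodule F V,
    (∀ k m, δ k = some m → Module.finrank F (u k) = m) → ψ.Realize Empty.elim u

end Spaces

end SubspaceLattice

universe u v

/-! An admissible basis identifies `V` with `F ^ d`, its form becoming a nonzero multiple of `∑ xᵢ*
αᵢ yᵢ`. The factor does not affect orthogonality, so the two subspace lattices are isomorphic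
(`IsAdmissible.exists_equiv`, `latEquiv`). In `F ^ d` every subspace is the column space of a `d ×
d` matrix, so a counterexample to a universal lattice sentence is a finite tuple of field elements.
It suffices to express "being a counterexample" by an existential formula that does not depend on
the field (`IsExPred`); negating it gives the universal sentence (`IsExPred.exists_isUniversal`).

Values of lattice terms are handled by naming a matrix for each subterm. Sums become matrix
factorizations. For the orthogonal, the spanning matrix `P` is taken idempotent: with `D = diag(α)`,
the orthogonal of its column space is the column space of `1 - D⁻¹ P* D` (`orth_colSpace`).

A negated equation is existential too: idempotents `P`, `Q` spanning the two sides exist, and their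
column spaces agree iff `Q P = P` and `P Q = Q`, which is quantifier free and may be negated. Hence
a quantifier free lattice formula and its negation are both existential
(`isExPred_realize_of_isQF`). Dimension `m` is expressed by a `d × m` matrix with a left inverse and
the same column space (`finrank_colSpace_eq_iff`). -/

namespace SubspaceLattice

open FirstOrder FirstOrder.Language

/-! ## Existential definability, uniformly in the field -/

/-- A `*`-field together with a tuple of nonzero symmetric elements. -/
structure ScaledStarField (d : ℕ) where
  carrier : Type u
  [field : Field carrier]
  [starRing : StarRing carrier]
  scale : Fin d → carrier
  star_scale : ∀ i, star (scale i) = scale i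
  scale_ne_zero : ∀ i, scale i ≠ 0

namespace ScaledStarField

variable {d : ℕ}

instance : CoeSort (ScaledStarField.{u} d) (Type u) := ⟨carrier⟩

instance (K : ScaledStarField.{u} d) : Field K := K.field

instance (K : ScaledStarField.{u} d) : StarRing K := K.starRing

instance (K : ScaledStarField.{u} d) : (langFPlus d).Structure K := fieldStructure K.scale

end ScaledStarField

variable {d : ℕ} {ι κ : Type}

/-- Functions given by one term over all scaled `*`-fields. -/
def IsTermFun (f : ∀ K : ScaledStarField.{u} d, (ι → K) → K) : Prop :=
  ∃ t : (langFPlus d).Term ι, ∀ (K : ScaledStarField.{u} d) (v : ι → K), t.realize v = f K v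

namespace IsTermFun

variable {f g : ∀ K : ScaledStarField.{u} d, (ι → K) → K}

theorem var (i : ι) : IsTermFun fun (K : ScaledStarField.{u} d) (v : ι → K) => v i :=
  ⟨Term.var i, fun _ _ => rfl⟩

theorem scale (i : Fin d) : IsTermFun fun (K : ScaledStarField.{u} d) (_ : ι → K) => K.scale i :=
  ⟨(langF.con i).term, fun _ _ => Term.realize_constants⟩

theorem zero : IsTermFun fun (K : ScaledStarField.{u} d) (_ : ι → K) => (0 : K) :=
  ⟨Term.func (Sum.inl StarRingFunc.zero) ![], fun _ _ => rfl⟩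

theorem one : IsTermFun fun (K : ScaledStarField.{u} d) (_ : ι → K) => (1 : K) :=
  ⟨Term.func (Sum.inl StarRingFunc.one) ![], fun _ _ => rfl⟩

theorem add (hf : IsTermFun f) (hg : IsTermFun g) : IsTermFun fun K v => f K v + g K v := by
  obtain ⟨s, hs⟩ := hf
  obtain ⟨t, ht⟩ := hg
  exact ⟨Term.func (Sum.inl StarRingFunc.add) ![s, t], fun K v =>
    congrArg₂ (· + ·) (hs K v) (ht K v)⟩

theorem mul (hf : IsTermFun f) (hg : IsTermFun g) : IsTermFun fun K v => f K v * g K v := by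
  obtain ⟨s, hs⟩ := hf
  obtain ⟨t, ht⟩ := hg
  exact ⟨Term.func (Sum.inl StarRingFunc.mul) ![s, t], fun K v =>
    congrArg₂ (· * ·) (hs K v) (ht K v)⟩

theorem neg (hf : IsTermFun f) : IsTermFun fun K v => -f K v := by
  obtain ⟨s, hs⟩ := hf
  exact ⟨Term.func (Sum.inl StarRingFunc.neg) ![s], fun K v => congrArg (-·) (hs K v)⟩

theorem star (hf : IsTermFun f) : IsTermFun fun K v => Star.star (f K v) := by
  obtain ⟨s, hs⟩ := hf
  exact ⟨Term.func (Sum.inl StarRingFunc.star) ![s], fun K v => congrArg Star.star (hs K v)⟩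

theorem sum {σ : Type*} (s : Finset σ) {F : σ → ∀ K : ScaledStarField.{u} d, (ι → K) → K}
    (hF : ∀ i, IsTermFun (F i)) : IsTermFun fun K v => ∑ i ∈ s, F i K v := by
  classical
  induction s using Finset.induction_on with
  | empty => simpa using zero
  | insert i s hi ih => simpa [Finset.sum_insert hi] using (hF i).add ih

end IsTermFun

/-- Matrix valued functions all of whose entries are given by terms. -/
def IsTermMatrix {a b : Type} (A : ∀ K : ScaledStarField.{u} d, (ι → K) → Matrix a b K) : Prop :=
  ∀ i j, IsTermFun fun K v => A K v i j

namespace IsTermMatrix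

variable {a b c : Type}

theorem zero : IsTermMatrix fun (K : ScaledStarField.{u} d) (_ : ι → K) => (0 : Matrix a b K) :=
  fun _ _ => IsTermFun.zero

theorem diagonal [DecidableEq a] {f : a → ∀ K : ScaledStarField.{u} d, (ι → K) → K}
    (hf : ∀ i, IsTermFun (f i)) :
    IsTermMatrix fun K v => Matrix.diagonal fun i => f i K v := by
  intro i j
  by_cases h : i = j
  · subst h
    simpa using hf i
  · simpa [h] using IsTermFun.zero

theorem one [DecidableEq a] :
    IsTermMatrix fun (K : ScaledStarField.{u} d) (_ : ι → K) => (1 : Matrix a a K) :=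
  diagonal fun _ => IsTermFun.one

variable {A A' : ∀ K : ScaledStarField.{u} d, (ι → K) → Matrix a b K}
  {C : ∀ K : ScaledStarField.{u} d, (ι → K) → Matrix b c K}

theorem add (hA : IsTermMatrix A) (hA' : IsTermMatrix A') :
    IsTermMatrix fun K v => A K v + A' K v :=
  fun i j => (hA i j).add (hA' i j)

theorem sub (hA : IsTermMatrix A) (hA' : IsTermMatrix A') :
    IsTermMatrix fun K v => A K v - A' K v := by
  intro i j
  simpa [sub_eq_add_neg] using (hA i j).add (hA' i j).neg

theorem mul [Fintype b] (hA : IsTermMatrix A) (hC : IsTermMatrix C) :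
    IsTermMatrix fun K v => A K v * C K v :=
  fun i k => IsTermFun.sum _ fun j => (hA i j).mul (hC j k)

theorem conjTranspose (hA : IsTermMatrix A) :
    IsTermMatrix fun K v => (A K v).conjTranspose :=
  fun i j => (hA j i).star

/-- Weakening: carries a matrix into a context enlarged by newly quantified variables. -/
theorem comp (hA : IsTermMatrix A) (g : ι → κ) :
    IsTermMatrix fun (K : ScaledStarField.{u} d) (v : κ → K) => A K (v ∘ g) := by
  intro i j
  obtain ⟨t, ht⟩ := hA i j
  exact ⟨t.relabel g, fun K v => by rw [Term.realize_relabel, ht]⟩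

theorem last : IsTermMatrix fun (K : ScaledStarField.{u} d) (v : ι ⊕ (a × b) → K) =>
    (Matrix.of fun i j => v (Sum.inr (i, j))) :=
  fun _ _ => IsTermFun.var _

end IsTermMatrix

/-- Predicates given by one quantifier free formula over all scaled `*`-fields. -/
def IsQFPred (S : ∀ K : ScaledStarField.{u} d, (ι → K) → Prop) : Prop :=
  ∃ θ : (langFPlus d).Formula ι, θ.IsQF ∧
    ∀ (K : ScaledStarField.{u} d) (v : ι → K), θ.Realize v ↔ S K v

namespace IsQFPred

variable {S T : ∀ K : ScaledStarField.{u} d, (ι → K) → Prop}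

theorem true : IsQFPred fun (K : ScaledStarField.{u} d) (_ : ι → K) => True :=
  ⟨⊤, BoundedFormula.IsQF.top, fun _ _ => by simp⟩

theorem and (hS : IsQFPred S) (hT : IsQFPred T) : IsQFPred fun K v => S K v ∧ T K v := by
  obtain ⟨θ, hθ, h⟩ := hS
  obtain ⟨η, hη, h'⟩ := hT
  exact ⟨θ ⊓ η, hθ.inf hη, fun K v => by rw [Formula.realize_inf, h, h']⟩

theorem not (hS : IsQFPred S) : IsQFPred fun K v => ¬S K v := by
  obtain ⟨θ, hθ, h⟩ := hS
  exact ⟨θ.not, hθ.not, fun K v => by rw [Formula.realize_not, h]⟩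

theorem or (hS : IsQFPred S) (hT : IsQFPred T) : IsQFPred fun K v => S K v ∨ T K v := by
  simpa only [not_and_or, not_not] using (hS.not.and hT.not).not

theorem comp (hS : IsQFPred S) (g : ι → κ) :
    IsQFPred fun (K : ScaledStarField.{u} d) (v : κ → K) => S K (v ∘ g) := by
  obtain ⟨θ, hθ, h⟩ := hS
  exact ⟨θ.relabel g, BoundedFormula.IsQF.relabel hθ _, fun K v => by
    rw [Formula.realize_relabel, h]⟩

theorem forall_mem {σ : Type*} (s : Finset σ)
    {P : σ → ∀ K : ScaledStarField.{u} d, (ι → K) → Prop} (hP : ∀ i, IsQFPred (P i)) :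
    IsQFPred fun K v => ∀ i ∈ s, P i K v := by
  classical
  induction s using Finset.induction_on with
  | empty => simpa using true
  | insert i s _ ih => simpa using (hP i).and ih

theorem eq {f g : ∀ K : ScaledStarField.{u} d, (ι → K) → K} (hf : IsTermFun f)
    (hg : IsTermFun g) : IsQFPred fun K v => f K v = g K v := by
  obtain ⟨s, hs⟩ := hf
  obtain ⟨t, ht⟩ := hg
  exact ⟨s.equal t, (BoundedFormula.IsAtomic.equal _ _).isQF, fun K v => by
    rw [Formula.realize_equal, hs, ht]⟩

theorem matrix_eq {a b : Type} [Fintype a] [Fintype b]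
    {A A' : ∀ K : ScaledStarField.{u} d, (ι → K) → Matrix a b K} (hA : IsTermMatrix A)
    (hA' : IsTermMatrix A') : IsQFPred fun K v => A K v = A' K v := by
  simpa [← Matrix.ext_iff] using forall_mem Finset.univ fun i =>
    forall_mem Finset.univ fun j => eq (hA i j) (hA' i j)

end IsQFPred

/-- Predicates given by one existential formula over all scaled `*`-fields. -/
def IsExPred (R : ∀ K : ScaledStarField.{u} d, (ι → K) → Prop) : Prop :=
  ∃ κ : Type, Finite κ ∧ ∃ S : ∀ K : ScaledStarField.{u} d, (ι ⊕ κ → K) → Prop, IsQFPred S ∧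
    ∀ (K : ScaledStarField.{u} d) (v : ι → K), R K v ↔ ∃ w : κ → K, S K (Sum.elim v w)

theorem IsQFPred.isExPred {S : ∀ K : ScaledStarField.{u} d, (ι → K) → Prop} (hS : IsQFPred S) :
    IsExPred S :=
  ⟨Empty, inferInstance, fun K v => S K (v ∘ Sum.inl), hS.comp _, fun K v => by simp⟩

namespace IsExPred

variable {R T : ∀ K : ScaledStarField.{u} d, (ι → K) → Prop}

theorem congr (hR : IsExPred R) (h : ∀ K v, T K v ↔ R K v) : IsExPred T := by
  obtain ⟨κ, hκ, S, hS, hRS⟩ := hR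
  exact ⟨κ, hκ, S, hS, fun K v => (h K v).trans (hRS K v)⟩

theorem and (hR : IsExPred R) (hT : IsExPred T) : IsExPred fun K v => R K v ∧ T K v := by
  obtain ⟨κ, _, S, hS, hRS⟩ := hR
  obtain ⟨κ', _, S', hS', hTS⟩ := hT
  refine ⟨κ ⊕ κ', inferInstance, _,
    (hS.comp (Sum.map id Sum.inl)).and (hS'.comp (Sum.map id Sum.inr)), fun K v => ?_⟩
  simp only [hRS, hTS, Sum.elim_comp_map, Function.comp_id]
  exact ⟨fun ⟨⟨w, hw⟩, w', hw'⟩ => ⟨Sum.elim w w', hw, hw'⟩, fun ⟨w, h, h'⟩ => ⟨⟨_, h⟩, _, h'⟩⟩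

theorem or (hR : IsExPred R) (hT : IsExPred T) : IsExPred fun K v => R K v ∨ T K v := by
  obtain ⟨κ, _, S, hS, hRS⟩ := hR
  obtain ⟨κ', _, S', hS', hTS⟩ := hT
  refine ⟨κ ⊕ κ', inferInstance, _,
    (hS.comp (Sum.map id Sum.inl)).or (hS'.comp (Sum.map id Sum.inr)), fun K v => ?_⟩
  simp only [hRS, hTS, Sum.elim_comp_map, Function.comp_id]
  constructor
  · rintro (⟨w, hw⟩ | ⟨w, hw⟩)
    -- One tuple must serve both disjuncts; the witnesses of the other disjunct are irrelevant and
    -- set to `0`.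
    · exact ⟨Sum.elim w 0, .inl hw⟩
    · exact ⟨Sum.elim 0 w, .inr hw⟩
  · rintro ⟨w, hw | hw⟩
    · exact .inl ⟨_, hw⟩
    · exact .inr ⟨_, hw⟩

theorem forall_mem {σ : Type*} (s : Finset σ)
    {P : σ → ∀ K : ScaledStarField.{u} d, (ι → K) → Prop} (hP : ∀ i, IsExPred (P i)) :
    IsExPred fun K v => ∀ i ∈ s, P i K v := by
  classical
  induction s using Finset.induction_on with
  | empty => simpa using IsQFPred.true.isExPred
  | insert i s _ ih => simpa using (hP i).and ih

theorem exists_tuple [Finite κ] {P : ∀ K : ScaledStarField.{u} d, (ι ⊕ κ → K) → Prop}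
    (hP : IsExPred P) : IsExPred fun K v => ∃ w : κ → K, P K (Sum.elim v w) := by
  obtain ⟨κ', _, S, hS, hPS⟩ := hP
  refine ⟨κ ⊕ κ', inferInstance, _, hS.comp (Equiv.sumAssoc ι κ κ'), fun K v => ?_⟩
  have key : ∀ (w : κ → K) (w' : κ' → K),
      Sum.elim v (Sum.elim w w') ∘ Equiv.sumAssoc ι κ κ' = Sum.elim (Sum.elim v w) w' := by
    intro w w'
    ext ((i | i) | i) <;> rfl
  simp only [hPS]
  constructor
  · rintro ⟨w, w', h⟩
    exact ⟨Sum.elim w w', by rwa [key]⟩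
  · rintro ⟨w, h⟩
    rw [← Sum.elim_comp_inl_inr w, key] at h
    exact ⟨_, _, h⟩

/-- A matrix quantifier is a block of scalar quantifiers indexed by `a × b`, of a length independent
of the field. -/
theorem exists_matrix {a b : Type} [Finite a] [Finite b]
    {P : ∀ K : ScaledStarField.{u} d, (ι → K) → Matrix a b K → Prop}
    (hP : IsExPred fun (K : ScaledStarField.{u} d) (v : ι ⊕ (a × b) → K) =>
      P K (v ∘ Sum.inl) (Matrix.of fun i j => v (Sum.inr (i, j)))) :
    IsExPred fun K v => ∃ M, P K v M := by
  refine hP.exists_tuple.congr fun K v => ?_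
  constructor
  · rintro ⟨M, h⟩
    exact ⟨fun p => M p.1 p.2, h⟩
  · rintro ⟨w, h⟩
    exact ⟨_, h⟩

theorem _root_.FirstOrder.Language.BoundedFormula.IsUniversal.alls {L : FirstOrder.Language}
    {α : Type*} : ∀ {n : ℕ} {φ : L.BoundedFormula α n}, φ.IsUniversal → φ.alls.IsUniversal
  | 0, _, h => h
  | _ + 1, _, h => (BoundedFormula.IsUniversal.all h).alls

theorem exists_isUniversal {R : ∀ K : ScaledStarField.{u} d, (Empty → K) → Prop}
    (hR : IsExPred R) : ∃ φ : (langFPlus d).Sentence, φ.IsUniversal ∧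
      ∀ K : ScaledStarField.{u} d, K ⊨ φ ↔ ¬R K Empty.elim := by
  obtain ⟨κ, _, S, ⟨θ, hθ, hθS⟩, hRS⟩ := hR
  refine ⟨θ.not.iAlls κ, ?_, fun K => ?_⟩
  · unfold Formula.iAlls
    exact (BoundedFormula.IsQF.relabel hθ.not _).isUniversal.alls
  · have : (default : Empty → K) = Empty.elim := Subsingleton.elim _ _
    rw [Sentence.Realize, Formula.realize_iAlls, hRS, this]
    simp [hθS]

end IsExPred

/-! ## Column spaces of matrices -/

section ColSpace

variable {F : Type*} [Field F] {a b c d : Type*} [Fintype b] [Fintype c]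

/-- The column space of a matrix. -/
def colSpace (A : Matrix a b F) : Submodule F (a → F) := LinearMap.range A.mulVecLin

theorem mem_colSpace {A : Matrix a b F} {x : a → F} : x ∈ colSpace A ↔ ∃ y, A.mulVec y = x :=
  Iff.rfl

theorem colSpace_le_iff {A : Matrix a b F} {C : Matrix a c F} :
    colSpace A ≤ colSpace C ↔ ∃ X : Matrix c b F, A = C * X := by
  classical
  constructor
  · intro h
    have : ∀ j, ∃ y, C.mulVec y = A.col j := fun j =>
      h ⟨Pi.single j 1, by simp⟩
    choose y hy using this
    refine ⟨Matrix.of fun i j => y j i, Matrix.ext fun i j => ?_⟩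
    rw [← Matrix.col_apply A, ← hy]
    rfl
  · rintro ⟨X, rfl⟩ _ ⟨y, rfl⟩
    exact ⟨X.mulVec y, by simp⟩

theorem colSpace_eq_iff {A : Matrix a b F} {C : Matrix a c F} :
    colSpace A = colSpace C ↔ (∃ X : Matrix c b F, A = C * X) ∧ ∃ Y : Matrix b c F, C = A * Y := by
  rw [le_antisymm_iff, colSpace_le_iff, colSpace_le_iff]

theorem colSpace_eq_bot_iff {A : Matrix a b F} : colSpace A = ⊥ ↔ A = 0 := by
  classical
  rw [colSpace, LinearMap.range_eq_bot, ← Matrix.toLin'_apply', LinearEquiv.map_eq_zero_iff]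

theorem colSpace_eq_sup_iff {Q : Matrix a b F} {A C : Matrix a c F} :
    colSpace Q = colSpace A ⊔ colSpace C ↔
      (∃ X Y : Matrix c b F, Q = A * X + C * Y) ∧ (∃ Z : Matrix b c F, A = Q * Z) ∧
        ∃ W : Matrix b c F, C = Q * W := by
  classical
  rw [le_antisymm_iff, sup_le_iff, colSpace_le_iff, colSpace_le_iff]
  refine and_congr_left fun _ => ?_
  constructor
  · intro h
    have : ∀ j, ∃ y z, A.mulVec y + C.mulVec z = Q.col j := fun j => by
      obtain ⟨_, ⟨y, rfl⟩, _, ⟨z, rfl⟩, h⟩ :=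
        Submodule.mem_sup.1 (h (show Q.col j ∈ colSpace Q from ⟨Pi.single j 1, by simp⟩))
      exact ⟨y, z, h⟩
    choose y z hyz using this
    refine ⟨Matrix.of fun i j => y j i, Matrix.of fun i j => z j i, Matrix.ext fun i j => ?_⟩
    rw [← Matrix.col_apply Q, ← hyz]
    rfl
  · rintro ⟨X, Y, rfl⟩ _ ⟨y, rfl⟩
    refine Submodule.mem_sup.2 ⟨_, ⟨X.mulVec y, rfl⟩, _, ⟨Y.mulVec y, rfl⟩, ?_⟩
    simp

/-- An idempotent fixes exactly the vectors of its range. Unlike `colSpace_le_iff`, this criterion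
has no quantifier, so its negation is available as well. -/
theorem colSpace_le_iff_of_isIdempotentElem {P : Matrix b b F} (hP : IsIdempotentElem P)
    {A : Matrix b c F} : colSpace A ≤ colSpace P ↔ P * A = A := by
  rw [colSpace_le_iff]
  constructor
  · rintro ⟨X, rfl⟩
    rw [← Matrix.mul_assoc, hP.eq]
  · exact fun h => ⟨A, h.symm⟩

theorem exists_isIdempotentElem_colSpace_eq (U : Submodule F (b → F)) :
    ∃ P : Matrix b b F, IsIdempotentElem P ∧ colSpace P = U := by
  classical
  -- Any linear complement yields a projection onto `U`; orthogonality plays no role, which matters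
  -- because `U` may meet its orthogonal.
  obtain ⟨W, hW⟩ := U.exists_isCompl
  refine ⟨LinearMap.toMatrix' (U.projection W hW), ?_, ?_⟩
  · rw [IsIdempotentElem, ← LinearMap.toMatrix'_mul]
    congr 1
    exact Submodule.isIdempotentElem_projection hW
  · rw [colSpace, ← Matrix.toLin'_apply', Matrix.toLin'_toMatrix']
    exact Submodule.range_projection hW

theorem colSpace_surjective (U : Submodule F (b → F)) : ∃ P : Matrix b b F, colSpace P = U :=
  (exists_isIdempotentElem_colSpace_eq U).imp fun _ => And.right

/-- The columns of `X` form a basis of the column space: `Y` certifies their independence, `Z` and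
`W` the equality of spans. -/
theorem finrank_colSpace_eq_iff {P : Matrix b b F} {m : ℕ} :
    Module.finrank F (colSpace P) = m ↔
      ∃ (X : Matrix b (Fin m) F) (Y : Matrix (Fin m) b F) (Z : Matrix (Fin m) b F)
        (W : Matrix b (Fin m) F), Y * X = 1 ∧ P = X * Z ∧ X = P * W := by
  classical
  constructor
  · intro h
    let e : (Fin m → F) ≃ₗ[F] colSpace P := (Module.finBasisOfFinrankEq F _ h).equivFun.symm
    let f : (Fin m → F) →ₗ[F] (b → F) := (colSpace P).subtype ∘ₗ e.toLinearMap
    have hf : LinearMap.ker f = ⊥ :=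
      LinearMap.ker_eq_bot.2 ((colSpace P).injective_subtype.comp e.injective)
    obtain ⟨g, hg⟩ := f.exists_leftInverse_of_injective hf
    have hr : colSpace P = colSpace (LinearMap.toMatrix' f) := by
      rw [colSpace.eq_def (LinearMap.toMatrix' f), ← Matrix.toLin'_apply',
        Matrix.toLin'_toMatrix', LinearMap.range_comp]
      simp
    obtain ⟨⟨Z, hZ⟩, W, hW⟩ := colSpace_eq_iff.1 hr
    exact ⟨_, LinearMap.toMatrix' g, Z, W, by
      rw [← LinearMap.toMatrix'_comp, hg, LinearMap.toMatrix'_id], hZ, hW⟩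
  · rintro ⟨X, Y, Z, W, hYX, hZ, hW⟩
    rw [colSpace_eq_iff.2 ⟨⟨Z, hZ⟩, W, hW⟩, colSpace, LinearMap.finrank_range_of_inj,
      Module.finrank_fin_fun]
    intro x y hxy
    have := congrArg Y.mulVec hxy
    simpa [hYX] using this

end ColSpace

/-! ## The standard space with a diagonal form -/

section Diagonal

variable {F : Type*} [Field F] [StarRing F] {d : ℕ}

/-- The form `⟨x ∣ y⟩ = ∑ xᵢ* αᵢ yᵢ` on `F ^ d`. -/
def diagonalForm (α : Fin d → F) : (Fin d → F) →ₗ⋆[F] (Fin d → F) →ₗ[F] F :=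
  LinearMap.mk₂'ₛₗ (starRingEnd F) (RingHom.id F) (fun x y => ∑ i, star (x i) * α i * y i)
    (fun x x' y => by simp [add_mul, Finset.sum_add_distrib])
    (fun r x y => by
      simp [Finset.mul_sum, mul_comm, mul_left_comm, starRingEnd_apply])
    (fun x y y' => by simp [mul_add, Finset.sum_add_distrib])
    (fun r x y => by simp [Finset.mul_sum, mul_assoc, mul_comm, mul_left_comm])

theorem diagonalForm_apply (α x y : Fin d → F) :
    diagonalForm α x y = ∑ i, star (x i) * α i * y i := rfl

theorem diagonalForm_mulVec {α : Fin d → F} (hα : ∀ i, star (α i) = α i)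
    (P : Matrix (Fin d) (Fin d) F) (x y : Fin d → F) :
    diagonalForm α x (P.mulVec y) =
      ∑ j, star ((P.conjTranspose * Matrix.diagonal α).mulVec x j) * y j := by
  simp only [diagonalForm_apply, Matrix.mulVec, dotProduct, Matrix.mul_diagonal,
    Matrix.conjTranspose_apply, star_sum, star_mul', star_star, hα, Finset.mul_sum,
    Finset.sum_mul]
  rw [Finset.sum_comm]
  exact Finset.sum_congr rfl fun _ _ => Finset.sum_congr rfl fun _ _ => by ring

theorem orth_colSpace_eq_ker {α : Fin d → F} (hα : ∀ i, star (α i) = α i)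
    (P : Matrix (Fin d) (Fin d) F) :
    orth (diagonalForm α) (colSpace P) =
      LinearMap.ker (P.conjTranspose * Matrix.diagonal α).mulVecLin := by
  ext x
  change (∀ u ∈ colSpace P, diagonalForm α x u = 0) ↔
    (P.conjTranspose * Matrix.diagonal α).mulVec x = 0
  constructor
  · intro h
    ext j
    have := h _ ⟨Pi.single j 1, rfl⟩
    rw [Matrix.mulVecLin_apply, diagonalForm_mulVec hα] at this
    simpa [Pi.single_apply] using this
  · rintro h _ ⟨y, rfl⟩
    rw [Matrix.mulVecLin_apply, diagonalForm_mulVec hα, h]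
    simp

/-- The matrix `D⁻¹ P* D` is the adjoint of `P` for the form, hence idempotent, and the kernel of an
idempotent `R` is the range of `1 - R`. The inverse is a separate tuple `β` because the language of
`*`-rings has no inversion. -/
theorem orth_colSpace {α β : Fin d → F} (hα : ∀ i, star (α i) = α i)
    (hβ : ∀ i, β i * α i = 1) {P : Matrix (Fin d) (Fin d) F} (hP : IsIdempotentElem P) :
    orth (diagonalForm α) (colSpace P) =
      colSpace (1 - Matrix.diagonal β * (P.conjTranspose * Matrix.diagonal α)) := by
  have hβα : Matrix.diagonal β * Matrix.diagonal α = 1 := by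
    simp [Matrix.diagonal_mul_diagonal, hβ]
  have hαβ : Matrix.diagonal α * Matrix.diagonal β = 1 := mul_eq_one_comm.1 hβα
  set R := Matrix.diagonal β * (P.conjTranspose * Matrix.diagonal α) with hR
  have hR' : Matrix.diagonal α * R = P.conjTranspose * Matrix.diagonal α := by
    rw [hR, ← Matrix.mul_assoc, hαβ, Matrix.one_mul]
  have hRR : R * R = R := by
    conv_lhs => enter [1]; rw [hR]
    rw [Matrix.mul_assoc, Matrix.mul_assoc, hR', ← Matrix.mul_assoc P.conjTranspose,
      ← Matrix.conjTranspose_mul, hP.eq]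
  rw [orth_colSpace_eq_ker hα]
  ext x
  rw [LinearMap.mem_ker, Matrix.mulVecLin_apply, mem_colSpace]
  constructor
  · intro h
    refine ⟨x, ?_⟩
    rw [Matrix.sub_mulVec, hR, ← Matrix.mulVec_mulVec x (Matrix.diagonal β), h]
    simp
  · rintro ⟨y, rfl⟩
    rw [← hR', ← Matrix.mulVec_mulVec, Matrix.mulVec_mulVec y R, Matrix.mul_sub, hRR]
    simp

end Diagonal

/-! ## Translation of lattice formulas -/

section Translation

variable {d : ℕ} {ι : Type}

namespace ScaledStarField

/-- The subspaces of the standard space over a scaled `*`-field. -/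
abbrev Subspaces (K : ScaledStarField.{u} d) : Type u := Submodule K (Fin d → K)

instance (K : ScaledStarField.{u} d) : langL.Structure K.Subspaces :=
  latStructure (diagonalForm K.scale)

end ScaledStarField

/-! ### Existential definitions of relations between column spaces. -/

namespace IsExPred

variable {a b : Type} [Fintype a] [Fintype b]
  {A : ∀ K : ScaledStarField.{u} d, (ι → K) → Matrix a b K}

theorem matrix_eq {A' : ∀ K : ScaledStarField.{u} d, (ι → K) → Matrix a b K}
    (hA : IsTermMatrix A) (hA' : IsTermMatrix A') : IsExPred fun K v => A K v = A' K v :=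
  (IsQFPred.matrix_eq hA hA').isExPred

theorem exists_eq_mul {c : Type} [Fintype c]
    {C : ∀ K : ScaledStarField.{u} d, (ι → K) → Matrix a c K}
    (hA : IsTermMatrix A) (hC : IsTermMatrix C) :
    IsExPred fun K v => ∃ X : Matrix c b K, A K v = C K v * X :=
  exists_matrix (matrix_eq (hA.comp _) ((hC.comp _).mul .last))

theorem colSpace_eq {c : Type} [Fintype c]
    {C : ∀ K : ScaledStarField.{u} d, (ι → K) → Matrix a c K}
    (hA : IsTermMatrix A) (hC : IsTermMatrix C) :
    IsExPred fun K v => colSpace (A K v) = colSpace (C K v) := by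
  simp only [colSpace_eq_iff]
  exact (exists_eq_mul hA hC).and (exists_eq_mul hC hA)

theorem colSpace_eq_sup {C C' : ∀ K : ScaledStarField.{u} d, (ι → K) → Matrix a b K}
    (hA : IsTermMatrix A) (hC : IsTermMatrix C) (hC' : IsTermMatrix C') :
    IsExPred fun K v => colSpace (A K v) = colSpace (C K v) ⊔ colSpace (C' K v) := by
  simp only [colSpace_eq_sup_iff]
  refine .and ?_ ((exists_eq_mul hC hA).and (exists_eq_mul hC' hA))
  refine exists_matrix (exists_matrix (matrix_eq ((hA.comp _).comp _) ?_))
  exact (((hC.comp _).comp _).mul (IsTermMatrix.last.comp _)).add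
    (((hC'.comp _).comp _).mul .last)

theorem finrank_eq {P : ∀ K : ScaledStarField.{u} d, (ι → K) → Matrix a a K}
    (hP : IsTermMatrix P) (m : ℕ) :
    IsExPred fun K v => Module.finrank K (colSpace (P K v)) = m := by
  simp only [finrank_colSpace_eq_iff]
  refine exists_matrix (exists_matrix (exists_matrix (exists_matrix ?_)))
  refine .and (matrix_eq (.mul ?_ ?_) .one) (.and (matrix_eq ?_ (.mul ?_ ?_))
    (matrix_eq ?_ (.mul ?_ .last)))
  · exact (IsTermMatrix.last.comp _).comp _
  · exact ((IsTermMatrix.last.comp _).comp _).comp _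
  · exact (((hP.comp _).comp _).comp _).comp _
  · exact ((IsTermMatrix.last.comp _).comp _).comp _
  · exact IsTermMatrix.last.comp _
  · exact ((IsTermMatrix.last.comp _).comp _).comp _
  · exact (((hP.comp _).comp _).comp _).comp _

theorem isIdempotentElem {P : ∀ K : ScaledStarField.{u} d, (ι → K) → Matrix a a K}
    (hP : IsTermMatrix P) : IsExPred fun K v => IsIdempotentElem (P K v) :=
  matrix_eq (hP.mul hP) hP

end IsExPred

theorem colSpace_eq_orth_iff {K : ScaledStarField.{u} d}
    {Q : Matrix (Fin d) (Fin d) K} {U : K.Subspaces} :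
    colSpace Q = orth (diagonalForm K.scale) U ↔
      ∃ (P : Matrix (Fin d) (Fin d) K) (β : Matrix (Fin d) Unit K), colSpace P = U ∧
        IsIdempotentElem P ∧ (Matrix.diagonal fun i => β i () * K.scale i) = 1 ∧
        colSpace Q = colSpace (1 - Matrix.diagonal (fun i => β i ()) *
          (P.conjTranspose * Matrix.diagonal K.scale)) := by
  constructor
  -- The inverses of the scale enter as a one-column matrix, so that `exists_matrix` can quantify
  -- over them.
  · intro h
    obtain ⟨P, hP, rfl⟩ := exists_isIdempotentElem_colSpace_eq U
    refine ⟨P, Matrix.of fun i _ => (K.scale i)⁻¹, rfl, hP, ?_, ?_⟩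
    · simp [K.scale_ne_zero]
    · rw [h, orth_colSpace K.star_scale (fun i => inv_mul_cancel₀ (K.scale_ne_zero i)) hP]
      rfl
  · rintro ⟨P, β, rfl, hP, hβ, h⟩
    rw [h, orth_colSpace K.star_scale _ hP]
    intro i
    simpa using congrFun (congrFun hβ i) i

/-- The subspace `U` is known only through the definability of "`P` spans `U`". This is assumed in
every extended context, since it is applied to a matrix `P` that is itself newly quantified. -/
theorem IsExPred.colSpace_eq_orth {U : ∀ K : ScaledStarField.{u} d, (ι → K) → K.Subspaces}
    (hU : ∀ (κ : Type) (g : ι → κ)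
      (P : ∀ K : ScaledStarField.{u} d, (κ → K) → Matrix (Fin d) (Fin d) K),
      IsTermMatrix P → IsExPred fun K v => colSpace (P K v) = U K (v ∘ g))
    {Q : ∀ K : ScaledStarField.{u} d, (ι → K) → Matrix (Fin d) (Fin d) K} (hQ : IsTermMatrix Q) :
    IsExPred fun K v => colSpace (Q K v) = orth (diagonalForm K.scale) (U K v) := by
  simp only [colSpace_eq_orth_iff]
  refine exists_matrix (exists_matrix ?_)
  have hP := IsTermMatrix.last (d := d) (ι := ι) (a := Fin d) (b := Fin d) |>.comp
    (Sum.inl : _ → _ ⊕ (Fin d × Unit))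
  refine .and (hU _ (Sum.inl ∘ Sum.inl) _ hP) (.and (isIdempotentElem hP)
    (.and (matrix_eq ?_ .one) (colSpace_eq ((hQ.comp _).comp _) ?_)))
  · exact .diagonal fun i => (IsTermFun.var _).mul (IsTermFun.scale i)
  · exact IsTermMatrix.one.sub ((IsTermMatrix.diagonal fun i => IsTermFun.var _).mul
      (hP.conjTranspose.mul (.diagonal IsTermFun.scale)))

/-- The subspaces spanned by the columns of a tuple of matrices. -/
abbrev colSpaces {n : ℕ} (A : Fin n → ∀ K : ScaledStarField.{u} d, (ι → K) →
    Matrix (Fin d) (Fin d) K) (K : ScaledStarField.{u} d) (v : ι → K) : Fin n → K.Subspaces :=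
  fun k => colSpace (A k K v)

theorem isExPred_colSpace_eq_realize {n : ℕ} (t : langL.Term (Empty ⊕ Fin n)) {ι : Type}
    {A : Fin n → ∀ K : ScaledStarField.{u} d, (ι → K) → Matrix (Fin d) (Fin d) K}
    (hA : ∀ k, IsTermMatrix (A k))
    {Q : ∀ K : ScaledStarField.{u} d, (ι → K) → Matrix (Fin d) (Fin d) K} (hQ : IsTermMatrix Q) :
    IsExPred fun K v => colSpace (Q K v) = t.realize (Sum.elim Empty.elim (colSpaces A K v)) := by
  -- The context varies because subterms are evaluated next to the matrices naming their values.
  induction t generalizing ι with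
  | var i =>
    obtain i | k := i
    · exact i.elim
    · exact .colSpace_eq hQ (hA k)
  | func f ts ih =>
    cases f with
    | add =>
      have key : IsExPred fun K v => ∃ P P' : Matrix (Fin d) (Fin d) K,
          colSpace P = (ts 0).realize (Sum.elim Empty.elim (colSpaces A K v)) ∧
          colSpace P' = (ts 1).realize (Sum.elim Empty.elim (colSpaces A K v)) ∧
          colSpace (Q K v) = colSpace P ⊔ colSpace P' := by
        refine .exists_matrix (.exists_matrix (.and ?_ (.and ?_
          (.colSpace_eq_sup ((hQ.comp _).comp _) (IsTermMatrix.last.comp _) .last))))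
        · exact ih 0 (fun k => ((hA k).comp _).comp _) (IsTermMatrix.last.comp _)
        · exact ih 1 (fun k => ((hA k).comp _).comp _) .last
      refine key.congr fun K v => ?_
      change colSpace (Q K v) = (ts 0).realize _ ⊔ (ts 1).realize _ ↔ _
      constructor
      · intro h
        obtain ⟨P, hP⟩ :=
          colSpace_surjective ((ts 0).realize (Sum.elim Empty.elim (colSpaces A K v)))
        obtain ⟨P', hP'⟩ :=
          colSpace_surjective ((ts 1).realize (Sum.elim Empty.elim (colSpaces A K v)))
        exact ⟨P, P', hP, hP', by rw [h, hP, hP']⟩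
      · rintro ⟨P, P', hP, hP', h⟩
        rw [h, hP, hP']
    | zero =>
      exact (IsExPred.matrix_eq hQ .zero).congr fun K v => colSpace_eq_bot_iff
    | perp =>
      exact .colSpace_eq_orth (U := fun K v =>
        (ts 0).realize (Sum.elim Empty.elim (colSpaces A K v)))
        (fun κ g P hP => ih 0 (fun k => (hA k).comp g) hP) hQ

/-- Both polarities are proved together, as an implication uses the negation of its premise. -/
theorem isExPred_realize_of_isQF {n : ℕ} {ψ : langL.BoundedFormula Empty n} (hψ : ψ.IsQF)
    {A : Fin n → ∀ K : ScaledStarField.{u} d, (ι → K) → Matrix (Fin d) (Fin d) K}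
    (hA : ∀ k, IsTermMatrix (A k)) :
    (IsExPred fun K v => ψ.Realize Empty.elim (colSpaces A K v)) ∧
      IsExPred fun K v => ¬ψ.Realize Empty.elim (colSpaces A K v) := by
  induction hψ with
  | falsum =>
    exact ⟨IsQFPred.true.not.isExPred.congr fun K v => by simp [BoundedFormula.Realize],
      IsQFPred.true.isExPred.congr fun K v => by simp [BoundedFormula.Realize]⟩
  | of_isAtomic h =>
    cases h with
    | rel R _ => exact R.elim
    | equal s t =>
      constructor
      · have key : IsExPred fun K v => ∃ Q : Matrix (Fin d) (Fin d) K,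
            colSpace Q = s.realize (Sum.elim Empty.elim (colSpaces A K v)) ∧
            colSpace Q = t.realize (Sum.elim Empty.elim (colSpaces A K v)) :=
          .exists_matrix (.and (isExPred_colSpace_eq_realize s (fun k => (hA k).comp _) .last)
            (isExPred_colSpace_eq_realize t (fun k => (hA k).comp _) .last))
        refine key.congr fun K v => ?_
        rw [BoundedFormula.realize_bdEqual]
        constructor
        · intro h
          obtain ⟨Q, hQ⟩ :=
            colSpace_surjective (s.realize (Sum.elim Empty.elim (colSpaces A K v)))
          exact ⟨Q, hQ, hQ.trans h⟩
        · rintro ⟨Q, hQ, hQ'⟩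
          rw [← hQ, ← hQ']
      -- Idempotency of `P` and `Q` turns the two inclusions into `Q * P = P` and `P * Q = Q`, so
      -- the inequality of spaces needs no universal quantifier.
      · have key : IsExPred fun K v => ∃ P Q : Matrix (Fin d) (Fin d) K,
            colSpace P = s.realize (Sum.elim Empty.elim (colSpaces A K v)) ∧
            colSpace Q = t.realize (Sum.elim Empty.elim (colSpaces A K v)) ∧
            IsIdempotentElem P ∧ IsIdempotentElem Q ∧ ¬(Q * P = P ∧ P * Q = Q) := by
          have hP := IsTermMatrix.last (d := d) (ι := ι) (a := Fin d) (b := Fin d) |>.comp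
            (Sum.inl : _ → _ ⊕ (Fin d × Fin d))
          refine .exists_matrix (.exists_matrix (.and
            (isExPred_colSpace_eq_realize s (fun k => ((hA k).comp _).comp _) hP)
            (.and (isExPred_colSpace_eq_realize t (fun k => ((hA k).comp _).comp _) .last)
            (.and (.isIdempotentElem hP) (.and (.isIdempotentElem .last) ?_)))))
          exact (((IsQFPred.matrix_eq (.mul .last hP) hP).and
            (.matrix_eq (.mul hP .last) .last)).not).isExPred
        refine key.congr fun K v => ?_
        rw [BoundedFormula.realize_bdEqual]
        constructor
        · intro h
          obtain ⟨P, hP, hPs⟩ := exists_isIdempotentElem_colSpace_eq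
            (s.realize (Sum.elim Empty.elim (colSpaces A K v)))
          obtain ⟨Q, hQ, hQt⟩ := exists_isIdempotentElem_colSpace_eq
            (t.realize (Sum.elim Empty.elim (colSpaces A K v)))
          refine ⟨P, Q, hPs, hQt, hP, hQ, ?_⟩
          rwa [← colSpace_le_iff_of_isIdempotentElem hP,
            ← colSpace_le_iff_of_isIdempotentElem hQ, ← le_antisymm_iff, hPs, hQt]
        · rintro ⟨P, Q, hPs, hQt, hP, hQ, h⟩
          rwa [← colSpace_le_iff_of_isIdempotentElem hP,
            ← colSpace_le_iff_of_isIdempotentElem hQ, ← le_antisymm_iff, hPs, hQt] at h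
  | imp _ _ ih ih' =>
    exact ⟨(ih.2.or ih'.1).congr fun K v => by rw [BoundedFormula.realize_imp]; tauto,
      (ih.1.and ih'.2).congr fun K v => by rw [BoundedFormula.realize_imp]; tauto⟩

theorem isExPred_not_realize_of_isUniversal {n : ℕ} {φ : langL.BoundedFormula Empty n}
    (hφ : φ.IsUniversal) {ι : Type}
    {A : Fin n → ∀ K : ScaledStarField.{u} d, (ι → K) → Matrix (Fin d) (Fin d) K}
    (hA : ∀ k, IsTermMatrix (A k)) :
    IsExPred fun K v => ¬φ.Realize Empty.elim (colSpaces A K v) := by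
  induction hφ generalizing ι with
  | of_isQF h => exact (isExPred_realize_of_isQF h hA).2
  | @all n φ _ ih =>
    have key : IsExPred fun K v => ∃ P : Matrix (Fin d) (Fin d) K,
        ¬φ.Realize Empty.elim (Fin.snoc (colSpaces A K v) (colSpace P) : _ → K.Subspaces) := by
      -- The quantified subspace becomes the last entry of the tuple, represented by a matrix of
      -- fresh variables.
      refine .exists_matrix ((ih (A := Fin.snoc (fun k K v => A k K (v ∘ Sum.inl))
        fun K v => Matrix.of fun i j => v (Sum.inr (i, j))) ?_).congr fun K v => ?_)
      · refine Fin.lastCases ?_ fun k => ?_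
        · simpa only [Fin.snoc_last] using IsTermMatrix.last
        · simpa only [Fin.snoc_castSucc] using (hA k).comp _
      · refine not_congr (iff_of_eq (congrArg _ (funext (Fin.lastCases ?_ fun k => ?_))))
        · simp [colSpaces]
        · simp [colSpaces]
    refine key.congr fun K v => ?_
    rw [BoundedFormula.realize_all, not_forall]
    constructor
    · rintro ⟨U, hU⟩
      obtain ⟨P, rfl⟩ := colSpace_surjective U
      exact ⟨P, hU⟩
    · rintro ⟨P, hP⟩
      exact ⟨_, hP⟩

theorem exists_isUniversal_iff_models {φ : langL.Sentence} (hφ : φ.IsUniversal) :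
    ∃ φ' : (langFPlus d).Sentence, φ'.IsUniversal ∧ ∀ K : ScaledStarField.{u} d,
      K ⊨ φ' ↔ K.Subspaces ⊨ φ := by
  obtain ⟨φ', hφ', h⟩ := (isExPred_not_realize_of_isUniversal (d := d) hφ (ι := Empty)
    (A := fun k => k.elim0) (fun k => k.elim0)).exists_isUniversal
  refine ⟨φ', hφ', fun K => ?_⟩
  rw [h, not_not, Sentence.Realize, Formula.Realize]
  exact iff_of_eq (congrArg₂ (BoundedFormula.Realize (M := K.Subspaces) φ)
    (Subsingleton.elim _ _) (Subsingleton.elim _ _))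

theorem exists_isUniversal_iff_restricted {n : ℕ} {ψ : langL.BoundedFormula Empty n}
    (hψ : ψ.IsQF) (δ : Fin n → Option ℕ) :
    ∃ φ' : (langFPlus d).Sentence, φ'.IsUniversal ∧ ∀ K : ScaledStarField.{u} d,
      K ⊨ φ' ↔ LatModelsRestricted (diagonalForm K.scale) ψ δ := by
  have key : IsExPred fun (K : ScaledStarField.{u} d) (_ : Empty → K) =>
      -- A single tuple codes all `n` matrices, so the dimension conditions and the failure of `ψ`
      -- are stated in one context.
      ∃ w : (Fin n × Fin d × Fin d) → K,
        (∀ k ∈ Finset.univ, ∀ m, δ k = some m →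
          Module.finrank K (colSpace (Matrix.of fun i j => w (k, i, j))) = m) ∧
        ¬ψ.Realize Empty.elim
          (fun k => (colSpace (Matrix.of fun i j => w (k, i, j)) : K.Subspaces)) := by
    have hA : ∀ k : Fin n, IsTermMatrix fun (K : ScaledStarField.{u} d)
        (v : Empty ⊕ (Fin n × Fin d × Fin d) → K) =>
        (Matrix.of fun i j => v (Sum.inr (k, i, j))) := fun k i j => IsTermFun.var _
    refine IsExPred.exists_tuple (P := fun K v => (∀ k ∈ Finset.univ, ∀ m, δ k = some m →
          Module.finrank K (colSpace (Matrix.of fun i j => v (Sum.inr (k, i, j)))) = m) ∧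
        ¬ψ.Realize Empty.elim
          (fun k => (colSpace (Matrix.of fun i j => v (Sum.inr (k, i, j))) : K.Subspaces)))
      (.and (.forall_mem _ fun k => ?_) (isExPred_realize_of_isQF hψ hA).2)
    cases δ k with
    | none => simpa using IsQFPred.true.isExPred
    | some m => simpa using IsExPred.finrank_eq (hA k) m
  obtain ⟨φ', hφ', h⟩ := key.exists_isUniversal
  refine ⟨φ', hφ', fun K => ?_⟩
  rw [h]
  constructor
  · intro h' U hU
    choose P hP using fun k => colSpace_surjective (U k)
    by_contra hn
    refine h' ⟨fun p => P p.1 p.2.1 p.2.2, fun k _ m hm => ?_, fun hr => hn ?_⟩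
    · exact (congrArg (fun W : K.Subspaces => Module.finrank K W) (hP k)).trans (hU k m hm)
    · exact (funext hP : (fun k => colSpace (P k)) = U) ▸ hr
  · rintro h' ⟨w, hw, hn⟩
    exact hn (h' _ fun k m hm => hw k (Finset.mem_univ k) m hm)

end Translation

/-! ## Transfer to arbitrary inner product spaces -/

section Transfer

variable {F : Type*} [Field F] [StarRing F] {V W : Type*} [AddCommGroup V] [Module F V]
  [AddCommGroup W] [Module F W]

theorem map_orth {B : V →ₗ⋆[F] V →ₗ[F] F} {B' : W →ₗ⋆[F] W →ₗ[F] F} (e : V ≃ₗ[F] W) {c : F}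
    (hc : c ≠ 0) (h : ∀ x y, B x y = c * B' (e x) (e y)) (U : Submodule F V) :
    (orth B U).map e.toLinearMap = orth B' (U.map e.toLinearMap) := by
  ext x
  obtain ⟨x, rfl⟩ := e.surjective x
  have : ∀ u, B x u = 0 ↔ B' (e x) (e u) = 0 := fun u => by simp [h, hc]
  constructor
  · rintro ⟨y, hy, hyx⟩
    obtain rfl := e.injective hyx
    rintro _ ⟨u, hu, rfl⟩
    exact (this u).1 (hy u hu)
  · intro hx
    exact ⟨x, fun u hu => (this u).2 (hx _ ⟨u, hu, rfl⟩), rfl⟩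

/-- A similarity of spaces induces an isomorphism of their subspace lattices. -/
def latEquiv {B : V →ₗ⋆[F] V →ₗ[F] F} {B' : W →ₗ⋆[F] W →ₗ[F] F} (e : V ≃ₗ[F] W) {c : F}
    (hc : c ≠ 0) (h : ∀ x y, B x y = c * B' (e x) (e y)) :
    letI := latStructure B
    letI := latStructure B'
    Submodule F V ≃[langL] Submodule F W :=
  letI := latStructure B
  letI := latStructure B'
  { toEquiv := (Submodule.orderIsoMapComap e).toEquiv
    map_fun' := fun f x => by
      cases f with
      | add => exact Submodule.map_sup _ _ _
      | zero => exact Submodule.map_bot _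
      | perp => exact map_orth e hc h _
    map_rel' := fun r => r.elim }

theorem latModels_iff {B : V →ₗ⋆[F] V →ₗ[F] F} {B' : W →ₗ⋆[F] W →ₗ[F] F} (e : V ≃ₗ[F] W) {c : F}
    (hc : c ≠ 0) (h : ∀ x y, B x y = c * B' (e x) (e y)) (φ : langL.Sentence) :
    LatModels B φ ↔ LatModels B' φ :=
  letI := latStructure B
  letI := latStructure B'
  StrongHomClass.realize_sentence (latEquiv e hc h) φ

theorem latModelsRestricted_iff {B : V →ₗ⋆[F] V →ₗ[F] F} {B' : W →ₗ⋆[F] W →ₗ[F] F}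
    (e : V ≃ₗ[F] W) {c : F} (hc : c ≠ 0) (h : ∀ x y, B x y = c * B' (e x) (e y)) {n : ℕ}
    (ψ : langL.BoundedFormula Empty n) (δ : Fin n → Option ℕ) :
    LatModelsRestricted B ψ δ ↔ LatModelsRestricted B' ψ δ := by
  let := latStructure B
  let := latStructure B'
  let g : Submodule F V ≃[langL] Submodule F W := latEquiv e hc h
  have hg : ∀ U, Module.finrank F (g U) = Module.finrank F U := fun U =>
    LinearEquiv.finrank_map_eq e U
  have hr : ∀ u : Fin n → Submodule F V,
      ψ.Realize Empty.elim (g ∘ u) ↔ ψ.Realize Empty.elim u := fun u => by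
    rw [← StrongHomClass.realize_boundedFormula g ψ (v := Empty.elim) (xs := u)]
    exact iff_of_eq (congrArg (ψ.Realize · (g ∘ u)) (Subsingleton.elim _ _))
  constructor
  · intro H u hu
    obtain ⟨u, rfl⟩ := g.surjective.comp_left u
    exact (hr u).2 (H u fun k m hm => (hg (u k)).symm.trans (hu k m hm))
  · intro H u hu
    exact (hr u).1 (H (g ∘ u) fun k m hm => (hg (u k)).trans (hu k m hm))

theorem IsAdmissible.exists_equiv {d : ℕ} [NeZero d] {B : V →ₗ⋆[F] V →ₗ[F] F} {α : Fin d → F}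
    (hα : IsAdmissible B α) : ∃ (e : V ≃ₗ[F] (Fin d → F)) (c : F), c ≠ 0 ∧
      ∀ x y, B x y = c * diagonalForm α (e x) (e y) := by
  obtain ⟨v, hv, hαv⟩ := hα.exists_basis
  -- The similarity factor is `|v₁|`, as `|vᵢ| = |v₁| αᵢ`; were it zero, `α₁` would vanish.
  have hc : B (v 0) (v 0) ≠ 0 := fun h => hα.ne_zero 0 (by rw [hαv, h, mul_zero])
  refine ⟨v.equivFun, B (v 0) (v 0), hc, fun x y => ?_⟩
  conv_lhs => rw [← v.sum_equivFun x, ← v.sum_equivFun y]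
  simp only [map_sum, LinearMap.sum_apply, LinearMap.map_smulₛₗ, LinearMap.smul_apply,
    map_smul, smul_eq_mul, diagonalForm_apply, Finset.mul_sum]
  rw [Finset.sum_comm]
  refine Finset.sum_congr rfl fun i _ => ?_
  rw [Finset.sum_eq_single i (fun j _ hj => by simp [hv i j hj.symm]) (by simp), hαv i,
    starRingEnd_apply]
  field_simp

end Transfer

end SubspaceLattice

/-! ### The corollary: passage to coordinates combined with the translation. -/

open SubspaceLattice in
theorem corollary10 (d : ℕ) [NeZero d] :
    (∀ φ : langL.Sentence, φ.IsUniversal →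
      ∃ φ' : (langFPlus d).Sentence, φ'.IsUniversal ∧
        ∀ (F : Type u) [Field F] [StarRing F] (V : Type v) [AddCommGroup V] [Module F V]
          [FiniteDimensional F V] (B : V →ₗ⋆[F] V →ₗ[F] F) (α : Fin d → F),
          IsInnerProduct B → Module.finrank F V = d → IsAdmissible B α →
          (LatModels B φ ↔ FieldModels α φ')) ∧
    (∀ (n : ℕ) (ψ : langL.BoundedFormula Empty n), ψ.IsQF →
      ∀ δ : Fin n → Option ℕ, (∀ k m, δ k = some m → m ≤ d) →
      ∃ φ' : (langFPlus d).Sentence, φ'.IsUniversal ∧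
        ∀ (F : Type u) [Field F] [StarRing F] (V : Type v) [AddCommGroup V] [Module F V]
          [FiniteDimensional F V] (B : V →ₗ⋆[F] V →ₗ[F] F) (α : Fin d → F),
          IsInnerProduct B → Module.finrank F V = d → IsAdmissible B α →
          (LatModelsRestricted B ψ δ ↔ FieldModels α φ')) := by
  constructor
  · intro φ hφ
    obtain ⟨φ', hφ', h⟩ := exists_isUniversal_iff_models.{u} (d := d) hφ
    refine ⟨φ', hφ', fun F _ _ V _ _ _ B α _ _ hα => ?_⟩
    obtain ⟨e, c, hc, he⟩ := hα.exists_equiv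
    exact (latModels_iff e hc he φ).trans (h ⟨F, α, hα.star_eq, hα.ne_zero⟩).symm
  · intro n ψ hψ δ _
    obtain ⟨φ', hφ', h⟩ := exists_isUniversal_iff_restricted.{u} (d := d) hψ δ
    refine ⟨φ', hφ', fun F _ _ V _ _ _ B α _ _ hα => ?_⟩
    obtain ⟨e, c, hc, he⟩ := hα.exists_equiv
    exact (latModelsRestricted_iff e hc he ψ δ).trans (h ⟨F, α, hα.star_eq, hα.ne_zero⟩).symm
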